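/- For a finite set $L$ of lines in $\mathbb{R}^3$, let $g(L)$ be the minimum integer $k$ for which there is a set $H$ of three distinct planes in $\mathbb{R}^3$ (of arbitrary orientation) such that every open cell of the arrangement of $H$, i.e. every connected component of $\mathbb{R}^3\setminus\bigcup_{h\in H}h$, meets at most $k$ lines of $L$. Let $g(n)$ be the maximum of $g(L)$ over all sets $L$ of $n$ distinct lines each of which is parallel to a coordinate axis. Then for every integer $n\ge 9$, $$g(n)\;\ge\;\left\lfloor \frac n3\right\rfloor-1 .$$ That is, there is a set $L$ of $n$ axis-parallel lines in $\mathbb{R}^3$ such that for every set $H$ of three distinct planes some open cell of the arrangement of $H$ meets at least $\lfloor n/3\rfloor-1$ lines of $L$. -/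

import Mathlib

/-- Euclidean three-space. -/
abbrev Space3 : Type := EuclideanSpace ℝ (Fin 3)

/-- A line of `ℝ³` parallel to one of the three coordinate axes. -/
def IsAxisParallelLine (l : AffineSubspace ℝ Space3) : Prop :=
  (l : Set Space3).Nonempty ∧
    ∃ i : Fin 3, l.direction = Submodule.span ℝ {EuclideanSpace.single i (1 : ℝ)}

/-- An arbitrary plane of `ℝ³` (in any orientation). -/
def IsPlane (h : AffineSubspace ℝ Space3) : Prop :=
  (h : Set Space3).Nonempty ∧ Module.finrank ℝ h.direction = 2

/-- The points of `ℝ³` that lie on none of the planes in `H`. -/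
def planesCompl (H : Finset (AffineSubspace ℝ Space3)) : Set Space3 :=
  {x | ∀ h ∈ H, x ∉ h}

/-- The open cells of the arrangement of `H`: the connected components of the complement of the
union of the planes in `H`. -/
def openCells (H : Finset (AffineSubspace ℝ Space3)) : Set (Set Space3) :=
  {C | ∃ x ∈ planesCompl H, C = connectedComponentIn (planesCompl H) x}

/-- The number of lines in `L` that meet the set `C`. -/
noncomputable def meetCount (L : Finset (AffineSubspace ℝ Space3)) (C : Set Space3) : ℕ :=
  {l : AffineSubspace ℝ Space3 | l ∈ L ∧ ((l : Set Space3) ∩ C).Nonempty}.ncard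

/-- `H` is a set of three (distinct) planes. -/
def IsPlaneTriple (H : Finset (AffineSubspace ℝ Space3)) : Prop :=
  H.card = 3 ∧ ∀ h ∈ H, IsPlane h

/-- The integers `k` such that some three planes leave only open cells that meet at most `k` lines
of `L`. -/
def achievable (L : Finset (AffineSubspace ℝ Space3)) : Set ℕ :=
  {k | ∃ H : Finset (AffineSubspace ℝ Space3), IsPlaneTriple H ∧
    ∀ C ∈ openCells H, meetCount L C ≤ k}

/-- `g(L)`: the minimum `k` such that some three planes leave only open cells that meet at most
`k` lines of `L`. -/
noncomputable def gLines (L : Finset (AffineSubspace ℝ Space3)) : ℕ :=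
  sInf (achievable L)

/-- The values `g(L)` over all sets `L` of `n` axis-parallel lines. -/
def gValues (n : ℕ) : Set ℕ :=
  {k | ∃ L : Finset (AffineSubspace ℝ Space3),
    L.card = n ∧ (∀ l ∈ L, IsAxisParallelLine l) ∧ gLines L = k}

/-- `g(n)`: the maximum of `g(L)` over all sets `L` of `n` axis-parallel lines. -/
noncomputable def gMax (n : ℕ) : ℕ :=
  sSup (gValues n)

/-! The minimum in `gLines` and the maximum in `gMax` are over nonempty, respectively bounded
nonempty sets, hence attained. -/

theorem meetCount_le_card (L : Finset (AffineSubspace ℝ Space3)) (C : Set Space3) :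
    meetCount L C ≤ L.card := by
  have h := Set.ncard_le_ncard (s := {l | l ∈ L ∧ ((l : Set Space3) ∩ C).Nonempty})
    (t := (L : Set (AffineSubspace ℝ Space3))) (fun l hl => hl.1) L.finite_toSet
  rwa [Set.ncard_coe_finset] at h

theorem exists_isPlaneTriple : ∃ H : Finset (AffineSubspace ℝ Space3), IsPlaneTriple H := by
  classical
  let f : Space3 →ₗ[ℝ] ℝ := (EuclideanSpace.proj (0 : Fin 3) : Space3 →L[ℝ] ℝ).toLinearMap
  let W : Submodule ℝ Space3 := LinearMap.ker f
  let P : ℕ → AffineSubspace ℝ Space3 := fun t =>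
    AffineSubspace.mk' (EuclideanSpace.single (0 : Fin 3) (t : ℝ)) W
  have hinj : Function.Injective P := by
    intro s t hst
    have h1 : EuclideanSpace.single (0 : Fin 3) (s : ℝ) ∈ P t := by
      rw [← hst]; exact AffineSubspace.self_mem_mk' _ _
    rw [AffineSubspace.mem_mk'] at h1
    have h2 : (s : ℝ) - t = 0 := by simpa [W, f] using h1
    exact_mod_cast sub_eq_zero.1 h2
  refine ⟨(Finset.range 3).image P, by
    rw [Finset.card_image_of_injective _ hinj, Finset.card_range], ?_⟩
  intro h hh
  obtain ⟨t, -, rfl⟩ := Finset.mem_image.1 hh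
  refine ⟨⟨_, AffineSubspace.self_mem_mk' _ _⟩, ?_⟩
  have hr : LinearMap.range f = ⊤ := by
    rw [LinearMap.range_eq_top]
    intro r
    exact ⟨EuclideanSpace.single 0 r, by simp [f]⟩
  have hk := LinearMap.finrank_range_add_finrank_ker f
  rw [hr, finrank_top, Module.finrank_self, finrank_euclideanSpace_fin] at hk
  rw [AffineSubspace.direction_mk']
  have h3 : 1 + Module.finrank ℝ W = 3 := hk
  omega

theorem card_mem_achievable (L : Finset (AffineSubspace ℝ Space3)) : L.card ∈ achievable L := by
  obtain ⟨H, hH⟩ := exists_isPlaneTriple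
  exact ⟨H, hH, fun C _ => meetCount_le_card L C⟩

theorem isLeast_gLines (L : Finset (AffineSubspace ℝ Space3)) :
    IsLeast (achievable L) (gLines L) :=
  ⟨Nat.sInf_mem ⟨_, card_mem_achievable L⟩, fun _ hk => Nat.sInf_le hk⟩

theorem bddAbove_gValues (n : ℕ) : BddAbove (gValues n) := by
  refine ⟨n, ?_⟩
  rintro k ⟨L, hL, -, rfl⟩
  exact hL ▸ (isLeast_gLines L).2 (card_mem_achievable L)

theorem gValues_nonempty (n : ℕ) : (gValues n).Nonempty := by
  classical
  let W : Submodule ℝ Space3 := Submodule.span ℝ {EuclideanSpace.single (0 : Fin 3) (1 : ℝ)}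
  let P : ℕ → AffineSubspace ℝ Space3 := fun t =>
    AffineSubspace.mk' (EuclideanSpace.single (1 : Fin 3) (t : ℝ)) W
  have hinj : Function.Injective P := by
    intro s t hst
    have h1 : EuclideanSpace.single (1 : Fin 3) (s : ℝ) ∈ P t := by
      rw [← hst]; exact AffineSubspace.self_mem_mk' _ _
    rw [AffineSubspace.mem_mk', Submodule.mem_span_singleton] at h1
    obtain ⟨a, ha⟩ := h1
    have h2 := congrArg (fun v : Space3 => v 1) ha
    have h3 : (0 : ℝ) = s - t := by simpa using h2
    exact_mod_cast sub_eq_zero.1 h3.symm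
  refine ⟨_, (Finset.range n).image P, by
    rw [Finset.card_image_of_injective _ hinj, Finset.card_range], ?_, rfl⟩
  intro l hl
  obtain ⟨t, -, rfl⟩ := Finset.mem_image.1 hl
  exact ⟨⟨_, AffineSubspace.self_mem_mk' _ _⟩, 0, AffineSubspace.direction_mk' _ _⟩

theorem isGreatest_gMax (n : ℕ) : IsGreatest (gValues n) (gMax n) :=
  ⟨Nat.sSup_mem (gValues_nonempty n) (bddAbove_gValues n),
    fun _ hk => le_csSup (bddAbove_gValues n) hk⟩

/-! The lines of direction `i` cross the coordinate plane orthogonal to that axis in the points `(t,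
-t²)` of a parabola, `1 ≤ t ≤ m`, where `m = ⌊n/3⌋`. A plane parallel to the axis has constant sign
on each of these lines and contains at most two of them. Every other plane is crossed once, so far
out its sign depends only on the end of the line. Suppose that every cell meets at most `m - 2`
lines. Then every axis is parallel to one of the planes, since otherwise a single cell contains an
end of all `m` lines of that direction.

If no plane is orthogonal to an axis, each plane is parallel to at most one axis, so planes and axes
are matched bijectively. For any two directions some pair of opposite cells catches all their lines
not contained in the matching planes. As `2m - z ≤ 2(m - 2)`, each plane contains exactly two lines.
Two points of the parabola with positive parameters determine the sign of a product of coefficients,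
and these signs let one pair of opposite cells serve all three directions: `3m - 6 ≤ 2(m - 2)`,
impossible for `m ≥ 3` (`false_of_three_oblique`).

If a plane is orthogonal to axis `k`, the choice of signs in `(t, -t²)` matters: the coordinate
`x_k` is positive on one of the two other directions and negative on the other, so one of them lies
strictly on one side of the plane (`exists_allPos`). In each configuration (`false_of_orthogonal`)
either one cell meets a whole direction, or two or three cells together catch too many lines. -/

/-- An affine functional on `ℝ³`, given by its linear part and the constant subtracted from it. -/
abbrev AffineForm : Type := (Fin 3 → ℝ) × ℝ

/-- The value of an affine functional at a point. -/
def AffineForm.eval (f : AffineForm) (p : Fin 3 → ℝ) : ℝ := ∑ k, f.1 k * p k - f.2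

theorem AffineForm.eval_smul (a : ℝ) (f : AffineForm) (p : Fin 3 → ℝ) :
    AffineForm.eval (a • f) p = a * f.eval p := by
  simp only [AffineForm.eval, Prod.smul_fst, Prod.smul_snd, Pi.smul_apply, smul_eq_mul,
    Fin.sum_univ_three]
  ring

/-- The point with parameter `s` on the line number `t` among the lines parallel to axis `i`. -/
def linePoint (i : Fin 3) (t : ℕ) (s : ℝ) : Fin 3 → ℝ :=
  fun l => if l = i then s else if l = i + 1 then (t : ℝ) else -(t : ℝ) ^ 2

theorem eval_linePoint (f : AffineForm) (i : Fin 3) (t : ℕ) (s : ℝ) :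
    f.eval (linePoint i t s) = f.1 i * s + f.eval (linePoint i t 0) := by
  fin_cases i <;> simp [AffineForm.eval, linePoint, Fin.sum_univ_three] <;> ring

theorem eval_linePoint_zero (f : AffineForm) (i : Fin 3) (t : ℕ) :
    f.eval (linePoint i t 0) = f.1 (i + 1) * t - f.1 (i + 2) * t ^ 2 - f.2 := by
  fin_cases i <;> simp [AffineForm.eval, linePoint, Fin.sum_univ_three] <;> ring

/-- The number of lines parallel to axis `i` whose base point has a positive value under `f`. -/
noncomputable def posCount (m : ℕ) (i : Fin 3) (f : AffineForm) : ℕ := by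
  classical
  exact ((Finset.Icc 1 m).filter fun t => 0 < f.eval (linePoint i t 0)).card

/-- The number of lines parallel to axis `i` whose base point is a zero of `f`. -/
noncomputable def zeroCount (m : ℕ) (i : Fin 3) (f : AffineForm) : ℕ := by
  classical
  exact ((Finset.Icc 1 m).filter fun t => f.eval (linePoint i t 0) = 0).card

/-- The number of lines parallel to axis `i` that meet the common positivity set of three
functionals. -/
noncomputable def hitCount (m : ℕ) (i : Fin 3) (f g h : AffineForm) : ℕ := by
  classical
  exact ((Finset.Icc 1 m).filter fun t => ∃ s, 0 < f.eval (linePoint i t s) ∧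
    0 < g.eval (linePoint i t s) ∧ 0 < h.eval (linePoint i t s)).card

/-- Every sign cell of the three functionals meets at most `m - 2` of the `3 * m` lines. -/
def AllCellsLight (m : ℕ) (f g h : AffineForm) : Prop :=
  ∀ a b c : ℝ, a ≠ 0 → b ≠ 0 → c ≠ 0 →
    ∑ i, hitCount m i (a • f) (b • g) (c • h) + 2 ≤ m

/-- All lines parallel to axis `i` lie strictly on the positive side of `f`. -/
def AllPos (m : ℕ) (i : Fin 3) (f : AffineForm) : Prop :=
  ∀ t ∈ Finset.Icc 1 m, 0 < f.eval (linePoint i t 0)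

section

variable {m : ℕ} {i j k : Fin 3} {f g h : AffineForm}

theorem hitCount_swap12 : hitCount m i f g h = hitCount m i g f h := by
  classical
  exact congrArg Finset.card (Finset.filter_congr fun _ _ => exists_congr fun _ => and_left_comm)

theorem hitCount_swap23 : hitCount m i f g h = hitCount m i f h g := by
  classical
  exact congrArg Finset.card (Finset.filter_congr fun _ _ => exists_congr fun _ =>
    and_congr_right fun _ => and_comm)

theorem hitCount_rotate : hitCount m i f g h = hitCount m i g h f :=
  hitCount_swap12.trans hitCount_swap23

theorem AllCellsLight.swap12 (H : AllCellsLight m f g h) : AllCellsLight m g f h := by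
  intro a b c ha hb hc
  simpa only [hitCount_swap12 (f := a • g)] using H b a c hb ha hc

theorem AllCellsLight.swap23 (H : AllCellsLight m f g h) : AllCellsLight m f h g := by
  intro a b c ha hb hc
  simpa only [hitCount_swap23 (g := b • h)] using H a c b ha hc hb

theorem AllCellsLight.sum_le (H : AllCellsLight m f g h) (hij : i ≠ j) (hik : i ≠ k) (hjk : j ≠ k)
    {a b c : ℝ} (ha : a ≠ 0) (hb : b ≠ 0) (hc : c ≠ 0) :
    hitCount m i (a • f) (b • g) (c • h) + hitCount m j (a • f) (b • g) (c • h)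
      + hitCount m k (a • f) (b • g) (c • h) + 2 ≤ m := by
  have h1 := H a b c ha hb hc
  rw [Fin.sum_univ_three] at h1
  revert hij hik hjk
  fin_cases i <;> fin_cases j <;> fin_cases k <;> simp <;> omega

theorem AllCellsLight.hitCount_le (H : AllCellsLight m f g h) (i : Fin 3)
    {a b c : ℝ} (ha : a ≠ 0) (hb : b ≠ 0) (hc : c ≠ 0) :
    hitCount m i (a • f) (b • g) (c • h) + 2 ≤ m :=
  le_trans (Nat.add_le_add_right
    (Finset.single_le_sum (f := fun i => hitCount m i (a • f) (b • g) (c • h))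
      (fun _ _ => Nat.zero_le _) (Finset.mem_univ i)) 2) (H a b c ha hb hc)

/-! ### Far ends of lines -/

/-- A functional that is positive far out on a line, in the direction given by the sign of `e`. -/
def FarPos (i : Fin 3) (e : ℝ) (t : ℕ) (f : AffineForm) : Prop :=
  0 < e * f.1 i ∨ f.1 i = 0 ∧ 0 < f.eval (linePoint i t 0)

theorem FarPos.eventually {e : ℝ} {t : ℕ} (H : FarPos i e t f) :
    ∀ᶠ s : ℝ in Filter.atTop, 0 < f.eval (linePoint i t (e * s)) := by
  rcases H with H | ⟨h0, H⟩
  · have h1 : Filter.Tendsto (fun s : ℝ => (e * f.1 i) * s) Filter.atTop Filter.atTop :=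
      Filter.tendsto_id.const_mul_atTop H
    filter_upwards [h1.eventually_gt_atTop (-f.eval (linePoint i t 0))] with s hs
    rw [eval_linePoint]
    linarith [mul_assoc e (f.1 i) s, mul_left_comm (f.1 i) e s, mul_assoc (f.1 i) e s,
      mul_comm (f.1 i) e]
  · refine Filter.Eventually.of_forall fun s => ?_
    rw [eval_linePoint, h0]
    simpa using H

theorem FarPos.exists_pos {e : ℝ} {t : ℕ} (hf : FarPos i e t f) (hg : FarPos i e t g)
    (hh : FarPos i e t h) : ∃ s, 0 < f.eval (linePoint i t s) ∧
      0 < g.eval (linePoint i t s) ∧ 0 < h.eval (linePoint i t s) := by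
  obtain ⟨s, h1, h2, h3⟩ := (hf.eventually.and (hg.eventually.and hh.eventually)).exists
  exact ⟨_, h1, h2, h3⟩

theorem le_hitCount {u : AffineForm} (e : ℝ)
    (H : ∀ t ∈ Finset.Icc 1 m, 0 < u.eval (linePoint i t 0) →
      FarPos i e t f ∧ FarPos i e t g ∧ FarPos i e t h) :
    posCount m i u ≤ hitCount m i f g h := by
  classical
  refine Finset.card_le_card fun t ht => ?_
  rw [Finset.mem_filter] at ht ⊢
  obtain ⟨h1, h2, h3⟩ := H t ht.1 ht.2
  exact ⟨ht.1, h1.exists_pos h2 h3⟩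

theorem eq_hitCount (e : ℝ)
    (H : ∀ t ∈ Finset.Icc 1 m, FarPos i e t f ∧ FarPos i e t g ∧ FarPos i e t h) :
    m ≤ hitCount m i f g h := by
  classical
  have h1 : (Finset.Icc 1 m).card ≤ hitCount m i f g h := by
    refine Finset.card_le_card fun t ht => ?_
    rw [Finset.mem_filter]
    obtain ⟨h1, h2, h3⟩ := H t ht
    exact ⟨ht, h1.exists_pos h2 h3⟩
  simpa using h1

/-- Applied when `f.1 i = 0`: the sign at the base point is then the sign on the whole line, and a
zero means that the line is contained in the plane. -/
theorem posCount_add (f : AffineForm) (i : Fin 3) {a : ℝ} (ha : a ≠ 0) :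
    posCount m i (a • f) + posCount m i ((-a) • f) + zeroCount m i f = m := by
  classical
  have e1 : posCount m i (a • f) + posCount m i ((-a) • f) + zeroCount m i f
      = (Finset.Icc 1 m).card := by
    simp only [posCount, zeroCount, Finset.card_filter, ← Finset.sum_add_distrib,
      AffineForm.eval_smul]
    rw [Finset.card_eq_sum_ones]
    refine Finset.sum_congr rfl fun t _ => ?_
    generalize f.eval (linePoint i t 0) = x
    rcases eq_or_ne x 0 with rfl | hx
    · simp
    · rcases lt_or_gt_of_ne (mul_ne_zero ha hx) with h | h
      · rw [if_neg h.not_gt, if_pos (by linarith), if_neg hx]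
      · rw [if_pos h, if_neg (by linarith), if_neg hx]
  simpa using e1

theorem add_distinct (hij : i ≠ j) (hik : i ≠ k) (hjk : j ≠ k) :
    (j = i + 1 ∧ k = i + 2) ∨ (k = i + 1 ∧ j = i + 2) := by
  revert i j k; decide

theorem fin_three_add (i : Fin 3) :
    i + 1 + 1 = i + 2 ∧ i + 1 + 2 = i ∧ i = i + 2 + 1 ∧ i + 1 = i + 2 + 2 := by
  revert i; decide

/-! ### Planes against points of the parabola -/

/-- A plane containing two lines parallel to axis `i` has the other two coefficients of its
equation of the same sign. -/
theorem mul_pos_of_two_zeros {x y d s t : ℝ} (hs : 0 < s) (ht : 0 < t) (hst : s ≠ t)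
    (hxy : x ≠ 0 ∨ y ≠ 0) (h1 : x * s - y * s ^ 2 - d = 0) (h2 : x * t - y * t ^ 2 - d = 0) :
    0 < x * y := by
  -- The difference of the two equations, divided by `s - t`.
  have h3 : x = y * (s + t) := by
    have : (s - t) * (x - y * (s + t)) = 0 := by linear_combination h1 - h2
    rcases mul_eq_zero.1 this with h | h
    · exact absurd (sub_eq_zero.1 h) hst
    · linarith
  have hy : y ≠ 0 := by
    rintro rfl
    simp at h3
    simp [h3] at hxy
  rw [h3]
  have : 0 < y ^ 2 * (s + t) := by positivity
  linarith

theorem zeroCount_le_one (hij : i ≠ j) (hik : i ≠ k) (hjk : j ≠ k) (hf : f.1 j ≠ 0 ∨ f.1 k ≠ 0)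
    (hp : ¬ 0 < f.1 j * f.1 k) : zeroCount m i f ≤ 1 := by
  classical
  have hf' : (f.1 (i + 1) ≠ 0 ∨ f.1 (i + 2) ≠ 0) ∧ ¬ 0 < f.1 (i + 1) * f.1 (i + 2) := by
    rcases add_distinct hij hik hjk with ⟨rfl, rfl⟩ | ⟨rfl, rfl⟩
    · exact ⟨hf, hp⟩
    · exact ⟨hf.symm, by rwa [mul_comm]⟩
  refine Finset.card_le_one.2 fun s hs t ht => ?_
  rw [Finset.mem_filter, Finset.mem_Icc, eval_linePoint_zero] at hs ht
  by_contra hne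
  exact hf'.2 (mul_pos_of_two_zeros (by exact_mod_cast hs.1.1) (by exact_mod_cast ht.1.1)
    (by exact_mod_cast hne) hf'.1 hs.2 ht.2)

/-- A nonzero polynomial of degree at most two has at most two roots; the proof takes divided
differences at three of them. -/
theorem zeroCount_le_two (hij : i ≠ j) (hik : i ≠ k) (hjk : j ≠ k)
    (hf : f.1 j ≠ 0 ∨ f.1 k ≠ 0) : zeroCount m i f ≤ 2 := by
  classical
  have hf' : f.1 (i + 1) ≠ 0 ∨ f.1 (i + 2) ≠ 0 := by
    rcases add_distinct hij hik hjk with ⟨rfl, rfl⟩ | ⟨rfl, rfl⟩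
    · exact hf
    · exact hf.symm
  by_contra hcon
  obtain ⟨r, s, t, hr, hs, ht, hrs, hrt, hst⟩ := Finset.two_lt_card_iff.1 (not_le.1 hcon)
  rw [Finset.mem_filter, eval_linePoint_zero] at hr hs ht
  have hrs' : (r : ℝ) - s ≠ 0 := sub_ne_zero.2 (by exact_mod_cast hrs)
  have hrt' : (r : ℝ) - t ≠ 0 := sub_ne_zero.2 (by exact_mod_cast hrt)
  have hst' : (s : ℝ) - t ≠ 0 := sub_ne_zero.2 (by exact_mod_cast hst)
  have e1 : f.1 (i + 1) - f.1 (i + 2) * (r + s) = 0 :=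
    (mul_eq_zero.1 (by linear_combination hr.2 - hs.2 :
      ((r : ℝ) - s) * (f.1 (i + 1) - f.1 (i + 2) * (r + s)) = 0)).resolve_left hrs'
  have e2 : f.1 (i + 1) - f.1 (i + 2) * (r + t) = 0 :=
    (mul_eq_zero.1 (by linear_combination hr.2 - ht.2 :
      ((r : ℝ) - t) * (f.1 (i + 1) - f.1 (i + 2) * (r + t)) = 0)).resolve_left hrt'
  have e3 : f.1 (i + 2) = 0 :=
    (mul_eq_zero.1 (by linear_combination e2 - e1 :
      ((s : ℝ) - t) * f.1 (i + 2) = 0)).resolve_left hst'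
  have e4 : f.1 (i + 1) = 0 := by simpa [e3] using e1
  exact hf'.elim (fun h => h e4) (fun h => h e3)

/-- A plane orthogonal to axis `k` has all lines of one of the two other directions strictly on
one side. -/
theorem exists_allPos (hij : i ≠ j) (hik : i ≠ k) (hjk : j ≠ k) (hi : f.1 i = 0) (hj : f.1 j = 0)
    (hk : f.1 k ≠ 0) :
    (∃ a : ℝ, a ≠ 0 ∧ AllPos m i (a • f)) ∨ ∃ a : ℝ, a ≠ 0 ∧ AllPos m j (a • f) := by
  wlog h : j = i + 1 ∧ k = i + 2 generalizing i j
  · refine (this hij.symm hjk hik hj hi ?_).symm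
    rcases add_distinct hij hik hjk with h' | ⟨rfl, rfl⟩
    · exact absurd h' h
    · exact (fin_three_add i).2.2
  obtain ⟨rfl, rfl⟩ := h
  obtain ⟨e1, e2, -⟩ := fin_three_add i
  have hkk := mul_self_pos.2 hk
  -- The coordinate `x_{i+2}` is `-t² < 0` on direction `i` and `t > 0` on direction `i + 1`. The
  -- side of the origin on which the plane lies decides which direction it does not cut.
  rcases le_total 0 (f.1 (i + 2) * f.2) with hd | hd
  · refine Or.inl ⟨-f.1 (i + 2), neg_ne_zero.2 hk, fun t ht => ?_⟩
    have ht : (0 : ℝ) < t := by exact_mod_cast (Finset.mem_Icc.1 ht).1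
    rw [AffineForm.eval_smul, eval_linePoint_zero, hj]
    have : 0 < (f.1 (i + 2) * f.1 (i + 2)) * (t : ℝ) ^ 2 := by positivity
    linarith
  · refine Or.inr ⟨f.1 (i + 2), hk, fun t ht => ?_⟩
    have ht : (0 : ℝ) < t := by exact_mod_cast (Finset.mem_Icc.1 ht).1
    rw [AffineForm.eval_smul, eval_linePoint_zero, e1, e2, hi]
    have : 0 < (f.1 (i + 2) * f.1 (i + 2)) * (t : ℝ) := by positivity
    linarith

theorem farPos_of_pos {e : ℝ} {t : ℕ} (h0 : f.1 i = 0) (a : ℝ)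
    (H : 0 < (a • f).eval (linePoint i t 0)) : FarPos i e t (a • f) :=
  Or.inr ⟨by simp [h0], H⟩

theorem farPos_of_coeff {e : ℝ} {t : ℕ} (a : ℝ) (H : 0 < e * (a * f.1 i)) : FarPos i e t (a • f) :=
  Or.inl (by simpa using H)

/-! ### Light cells: one or two directions -/

namespace AllCellsLight

variable {a b c : ℝ}

/-- Lines parallel to exactly one of the planes. -/
theorem posCount_le_one_parallel (hf : f.1 i = 0) (hb : b ≠ 0) (hbc : 0 < b * c * (g.1 i * h.1 i)) :
    posCount m i (a • f) ≤ hitCount m i (a • f) (b • g) (c • h) := by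
  have hg : g.1 i ≠ 0 := by rintro h; simp [h] at hbc
  refine le_hitCount (b * g.1 i) fun t _ ht => ⟨farPos_of_pos hf a ht, farPos_of_coeff b ?_,
    farPos_of_coeff c (by linarith)⟩
  exact mul_self_pos.2 (mul_ne_zero hb hg)

/-- Lines parallel to exactly two of the planes, strictly on one side of the first. -/
theorem posCount_le_two_parallel (hf : f.1 i = 0) (hg : g.1 i = 0) (hh : h.1 i ≠ 0)
    (hc : c ≠ 0) (hpos : AllPos m i (a • f)) :
    posCount m i (b • g) ≤ hitCount m i (a • f) (b • g) (c • h) :=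
  le_hitCount (c * h.1 i) fun t h1 ht => ⟨farPos_of_pos hf a (hpos t h1), farPos_of_pos hg b ht,
    farPos_of_coeff c (mul_self_pos.2 (mul_ne_zero hc hh))⟩

/-- Scaling each functional by its own coefficient makes all three increase along the axis, so all
`m` lines end in one cell. -/
theorem exists_parallel (H : AllCellsLight m f g h) (i : Fin 3) :
    f.1 i = 0 ∨ g.1 i = 0 ∨ h.1 i = 0 := by
  by_contra! hcon
  obtain ⟨hf, hg, hh⟩ := hcon
  have h1 := H.hitCount_le i hf hg hh
  have h2 : m ≤ hitCount m i (f.1 i • f) (g.1 i • g) (h.1 i • h) :=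
    eq_hitCount 1 fun t _ => ⟨farPos_of_coeff _ (by rw [one_mul]; exact mul_self_pos.2 hf),
      farPos_of_coeff _ (by rw [one_mul]; exact mul_self_pos.2 hg),
      farPos_of_coeff _ (by rw [one_mul]; exact mul_self_pos.2 hh)⟩
  omega

theorem false_of_allPos_one (H : AllCellsLight m f g h) (hf : f.1 i = 0) (hg : g.1 i ≠ 0)
    (hh : h.1 i ≠ 0) (ha : a ≠ 0) (hpos : AllPos m i (a • f)) : False := by
  have h1 := H.hitCount_le i ha hg hh
  have h2 : m ≤ hitCount m i (a • f) (g.1 i • g) (h.1 i • h) :=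
    eq_hitCount 1 fun t ht => ⟨farPos_of_pos hf _ (hpos t ht),
      farPos_of_coeff _ (by rw [one_mul]; exact mul_self_pos.2 hg),
      farPos_of_coeff _ (by rw [one_mul]; exact mul_self_pos.2 hh)⟩
  omega

theorem false_of_allPos_two (H : AllCellsLight m f g h) (hf : f.1 i = 0) (hg : g.1 i = 0)
    (hh : h.1 i ≠ 0) (ha : a ≠ 0) (hb : b ≠ 0) (hpf : AllPos m i (a • f))
    (hpg : AllPos m i (b • g)) : False := by
  have h1 := H.hitCount_le i ha hb hh
  have h2 : m ≤ hitCount m i (a • f) (b • g) (h.1 i • h) :=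
    eq_hitCount 1 fun t ht => ⟨farPos_of_pos hf _ (hpf t ht), farPos_of_pos hg _ (hpg t ht),
      farPos_of_coeff _ (by rw [one_mul]; exact mul_self_pos.2 hh)⟩
  omega

theorem false_of_allPos_three (H : AllCellsLight m f g h) (hf : f.1 i = 0) (hg : g.1 i = 0)
    (hh : h.1 i = 0) (ha : a ≠ 0) (hb : b ≠ 0) (hc : c ≠ 0) (hpf : AllPos m i (a • f))
    (hpg : AllPos m i (b • g)) (hph : AllPos m i (c • h)) : False := by
  have h1 := H.hitCount_le i ha hb hc
  have h2 : m ≤ hitCount m i (a • f) (b • g) (c • h) :=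
    eq_hitCount 1 fun t ht => ⟨farPos_of_pos hf _ (hpf t ht), farPos_of_pos hg _ (hpg t ht),
      farPos_of_pos hh _ (hph t ht)⟩
  omega

/-- Two directions, each parallel to exactly one of the planes, these two planes being different. -/
theorem four_le_zeroCount (H : AllCellsLight m f g h) (hij : i ≠ j) (hik : i ≠ k) (hjk : j ≠ k)
    (hfi : f.1 i = 0) (hgi : g.1 i ≠ 0) (hhi : h.1 i ≠ 0)
    (hfj : f.1 j ≠ 0) (hgj : g.1 j = 0) (hhj : h.1 j ≠ 0) :
    4 ≤ zeroCount m i f + zeroCount m j g := by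
  -- The weights give `f` and `h` the same sign at one end of the `j`-lines, and `g` and `h` the
  -- same sign at one end of the `i`-lines. Negating all three weights preserves this, so the
  -- opposite cell works too.
  have ha : f.1 j * h.1 j ≠ 0 := mul_ne_zero hfj hhj
  have hb : g.1 i * h.1 i ≠ 0 := mul_ne_zero hgi hhi
  have h1 := H.sum_le hij hik hjk ha hb one_ne_zero
  have h2 := H.sum_le hij hik hjk (neg_ne_zero.2 ha) (neg_ne_zero.2 hb)
    (neg_ne_zero.2 (one_ne_zero (α := ℝ)))
  have key : ∀ e : ℝ, e ≠ 0 →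
      posCount m i ((e * (f.1 j * h.1 j)) • f)
        ≤ hitCount m i ((e * (f.1 j * h.1 j)) • f) ((e * (g.1 i * h.1 i)) • g) (e • h) ∧
      posCount m j ((e * (g.1 i * h.1 i)) • g)
        ≤ hitCount m j ((e * (f.1 j * h.1 j)) • f) ((e * (g.1 i * h.1 i)) • g) (e • h) := by
    intro e he
    constructor
    · refine posCount_le_one_parallel hfi (mul_ne_zero he hb) ?_
      have : 0 < (e * (g.1 i * h.1 i)) * (e * (g.1 i * h.1 i)) := mul_self_pos.2 (mul_ne_zero he hb)
      linarith
    · refine le_hitCount (e * h.1 j) fun t _ ht => ⟨farPos_of_coeff _ ?_, farPos_of_pos hgj _ ht,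
        farPos_of_coeff _ (mul_self_pos.2 (mul_ne_zero he hhj))⟩
      have : 0 < (e * (f.1 j * h.1 j)) * (e * (f.1 j * h.1 j)) :=
        mul_self_pos.2 (mul_ne_zero he ha)
      linarith
  have k1 := key 1 one_ne_zero
  have k2 := key (-1) (neg_ne_zero.2 one_ne_zero)
  simp only [one_mul, neg_one_mul] at k1 k2
  have p1 := posCount_add (m := m) f i ha
  have p2 := posCount_add (m := m) g j hb
  omega

end AllCellsLight

/-! ### A plane orthogonal to an axis -/

theorem zeroCount_orthogonal_le_one (hij : i ≠ j) (hik : i ≠ k) (hjk : j ≠ k) (hj : f.1 j = 0)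
    (hk : f.1 k ≠ 0) : zeroCount m i f ≤ 1 :=
  zeroCount_le_one hij hik hjk (Or.inr hk) (by simp [hj])

theorem AffineForm.eval_orthogonal (hij : i ≠ j) (hik : i ≠ k) (hjk : j ≠ k) (hi : f.1 i = 0)
    (hj : f.1 j = 0) (p : Fin 3 → ℝ) : f.eval p = f.1 k * p k - f.2 := by
  rw [AffineForm.eval, Finset.sum_eq_single k]
  · intro l _ hl
    have : l = i ∨ l = j := by clear * - hij hik hjk hl; revert i j k l; decide
    rcases this with rfl | rfl <;> simp [*]
  · simp

theorem linePoint_self (k : Fin 3) (t : ℕ) (s : ℝ) : linePoint k t s k = s := by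
  simp [linePoint]

namespace AllCellsLight

theorem posCount_le_two_parallel_rotate {a b c : ℝ} (hg : g.1 i = 0) (hh : h.1 i = 0)
    (hf : f.1 i ≠ 0) (ha : a ≠ 0) (hpos : AllPos m i (b • g)) :
    posCount m i (c • h) ≤ hitCount m i (a • f) (b • g) (c • h) := by
  rw [hitCount_rotate]
  exact posCount_le_two_parallel hg hh hf ha hpos

theorem posCount_le_two_parallel_rotate' {a b c : ℝ} (hh : h.1 i = 0) (hf : f.1 i = 0)
    (hg : g.1 i ≠ 0) (hb : b ≠ 0) (hpos : AllPos m i (c • h)) :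
    posCount m i (a • f) ≤ hitCount m i (a • f) (b • g) (c • h) := by
  rw [← hitCount_rotate]
  exact posCount_le_two_parallel hh hf hg hb hpos

/-- Two planes orthogonal to axis `k`, a third plane parallel to that axis, and a second direction
`j` whose lines are on one side of the first plane. -/
theorem false_of_two_orthogonal_of_allPos (H : AllCellsLight m f g h)
    (hij : i ≠ j) (hik : i ≠ k) (hjk : j ≠ k) (hfi : f.1 i = 0) (hfj : f.1 j = 0)
    (hgi : g.1 i = 0) (hgj : g.1 j = 0) (hgk : g.1 k ≠ 0)
    (hhk : h.1 k = 0) (hhj : h.1 j ≠ 0) {a : ℝ} (ha : a ≠ 0) (hpos : AllPos m j (a • f)) :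
    False := by
  classical
  have hz : zeroCount m j g ≤ 1 := zeroCount_orthogonal_le_one hij.symm hjk hik hgi hgk
  have hzk : zeroCount m k h ≤ 2 := zeroCount_le_two hjk.symm hik.symm hij.symm (Or.inl hhj)
  have hj1 : ∀ e : ℝ, e ≠ 0 →
      posCount m j (e • g) ≤ hitCount m j (a • f) (e • g) (e • h) := fun e he =>
    posCount_le_two_parallel hfj hgj hhj he hpos
  -- Otherwise at least `m - 1` of the `j`-lines would reach one cell on the other side of `g`.
  have hne : ∀ e : ℝ, e ≠ 0 → 0 < posCount m j (e • g) := by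
    intro e he
    have h1 := posCount_add (m := m) g j he
    have h2 := hj1 (-e) (neg_ne_zero.2 he)
    have h3 := H.hitCount_le j ha (neg_ne_zero.2 he) (neg_ne_zero.2 he)
    omega
  have hk1 : ∀ e : ℝ, e ≠ 0 →
      posCount m k (e • h) ≤ hitCount m k (a • f) (e • g) (e • h) := by
    intro e he
    -- The functionals `f` and `g` depend only on `x_k`, so the height of one suitable `j`-line
    -- gives the right signs on every `k`-line.
    obtain ⟨t₀, ht₀⟩ := Finset.card_pos.1 (hne e he)
    rw [Finset.mem_filter] at ht₀
    have hf₀ := hpos t₀ ht₀.1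
    refine Finset.card_le_card fun t ht => ?_
    rw [Finset.mem_filter] at ht ⊢
    refine ⟨ht.1, linePoint j t₀ 0 k, ?_, ?_, ?_⟩
    · rw [AffineForm.eval_orthogonal hij hik hjk (by simp [hfi]) (by simp [hfj])] at hf₀ ⊢
      rwa [linePoint_self]
    · have hg₀ := ht₀.2
      rw [AffineForm.eval_orthogonal hij hik hjk (by simp [hgi]) (by simp [hgj])] at hg₀ ⊢
      rwa [linePoint_self]
    · rw [eval_linePoint]
      simpa [hhk] using ht.2
  have one : (1 : ℝ) ≠ 0 := one_ne_zero
  have none : (-1 : ℝ) ≠ 0 := neg_ne_zero.2 one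
  have s1 := H.sum_le hij hik hjk ha one one
  have s2 := H.sum_le hij hik hjk ha none none
  have p1 := posCount_add (m := m) g j one
  have p2 := posCount_add (m := m) h k one
  have := hj1 1 one
  have := hj1 (-1) none
  have := hk1 1 one
  have := hk1 (-1) none
  -- The two cells give `2m - 1 - 2 ≤ 2(m - 2)`.
  omega

theorem false_of_two_orthogonal (H : AllCellsLight m f g h)
    (hij : i ≠ j) (hik : i ≠ k) (hjk : j ≠ k) (hfi : f.1 i = 0) (hfj : f.1 j = 0) (hfk : f.1 k ≠ 0)
    (hgi : g.1 i = 0) (hgj : g.1 j = 0) (hgk : g.1 k ≠ 0)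
    (hhk : h.1 k = 0) (hh : h.1 i ≠ 0 ∨ h.1 j ≠ 0) : False := by
  wlog hhj : h.1 j ≠ 0 generalizing i j
  · exact this hij.symm hjk hik hfj hfi hgj hgi hh.symm (hh.resolve_right hhj)
  rcases exists_allPos (m := m) hij hik hjk hfi hfj hfk with ⟨a, ha, hpa⟩ | ⟨a, ha, hpa⟩
  swap
  · exact H.false_of_two_orthogonal_of_allPos hij hik hjk hfi hfj hgi hgj hgk hhk hhj ha hpa
  rcases exists_allPos (m := m) hij hik hjk hgi hgj hgk with ⟨b, hb, hpb⟩ | ⟨b, hb, hpb⟩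
  swap
  · exact H.swap12.false_of_two_orthogonal_of_allPos hij hik hjk hgi hgj hfi hfj hfk hhk hhj
      hb hpb
  by_cases hhi : h.1 i = 0
  · rcases exists_allPos (m := m) hik hij hjk.symm hhi hhk hhj with ⟨c, hc, hpc⟩ | ⟨c, hc, hpc⟩
    · exact H.false_of_allPos_three hfi hgi hhi ha hb hc hpa hpb hpc
    · exact H.swap23.swap12.false_of_allPos_one hhk hfk hgk hc hpc
  · exact H.false_of_allPos_two hfi hgi hhi ha hb hpa hpb

/-- Two orthogonal axis-orthogonal planes, and an oblique plane parallel to one of the axes. -/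
theorem false_of_orthogonal_of_oblique (H : AllCellsLight m f g h)
    (hij : i ≠ j) (hik : i ≠ k) (hjk : j ≠ k) (hfi : f.1 i = 0) (hfj : f.1 j = 0) (hfk : f.1 k ≠ 0)
    (hgi : g.1 i = 0) (hgj : g.1 j ≠ 0) (hgk : g.1 k = 0)
    (hhi : h.1 i ≠ 0) (hhj : h.1 j ≠ 0) (hhk : h.1 k = 0) : False := by
  rcases exists_allPos (m := m) hij hik hjk hfi hfj hfk with ⟨a, ha, hpa⟩ | ⟨a, ha, hpa⟩
  swap
  · exact H.false_of_allPos_one hfj hgj hhj ha hpa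
  rcases exists_allPos (m := m) hik hij hjk.symm hgi hgk hgj with ⟨b, hb, hpb⟩ | ⟨b, hb, hpb⟩
  · exact H.false_of_allPos_two hfi hgi hhi ha hb hpa hpb
  -- The sign of `c` makes `b • g` and `c • h` agree far out on the `j`-lines.
  obtain ⟨c, hcdef⟩ : ∃ c, c = b * (g.1 j * h.1 j) := ⟨_, rfl⟩
  have hc : c ≠ 0 := hcdef ▸ mul_ne_zero hb (mul_ne_zero hgj hhj)
  have hbc : 0 < b * c * (g.1 j * h.1 j) := by
    have : 0 < c * c := mul_self_pos.2 hc
    nth_rewrite 1 [hcdef] at this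
    linarith
  -- These three cells catch every line not contained in a plane: each direction is split between
  -- two of them. At most `1 + 1 + 2` lines are lost, and `3m - 4 > 3(m - 2)`.
  have s1 := H.sum_le hij hik hjk ha (neg_ne_zero.2 hb) (neg_ne_zero.2 hc)
  have s2 := H.sum_le hij hik hjk (neg_ne_zero.2 ha) hb hc
  have s3 := H.sum_le hij hik hjk ha hb (neg_ne_zero.2 hc)
  have q1 : posCount m i ((-b) • g) ≤ hitCount m i (a • f) ((-b) • g) ((-c) • h) :=
    posCount_le_two_parallel hfi hgi hhi (neg_ne_zero.2 hc) hpa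
  have q2 : posCount m j (a • f) ≤ hitCount m j (a • f) ((-b) • g) ((-c) • h) :=
    posCount_le_one_parallel hfj (neg_ne_zero.2 hb) (by linarith)
  have q3 : posCount m k (c • h) ≤ hitCount m k ((-a) • f) (b • g) (c • h) :=
    posCount_le_two_parallel_rotate hgk hhk hfk (neg_ne_zero.2 ha) hpb
  have q4 : posCount m j ((-a) • f) ≤ hitCount m j ((-a) • f) (b • g) (c • h) :=
    posCount_le_one_parallel hfj hb hbc
  have q5 : posCount m i (b • g) ≤ hitCount m i (a • f) (b • g) ((-c) • h) :=
    posCount_le_two_parallel hfi hgi hhi (neg_ne_zero.2 hc) hpa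
  have q6 : posCount m k ((-c) • h) ≤ hitCount m k (a • f) (b • g) ((-c) • h) :=
    posCount_le_two_parallel_rotate hgk hhk hfk ha hpb
  have p1 := posCount_add (m := m) g i hb
  have p2 := posCount_add (m := m) f j ha
  have p3 := posCount_add (m := m) h k hc
  have z1 : zeroCount m i g ≤ 1 := zeroCount_orthogonal_le_one hik hij hjk.symm hgk hgj
  have z2 : zeroCount m j f ≤ 1 := zeroCount_orthogonal_le_one hij.symm hjk hik hfi hfk
  have z3 : zeroCount m k h ≤ 2 := zeroCount_le_two hik.symm hjk.symm hij (Or.inl hhi)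
  omega

/-- Three mutually orthogonal axis-orthogonal planes, with the lines of each direction separated
from one of the planes. -/
theorem false_of_cyclic_allPos (H : AllCellsLight m f g h)
    (hij : i ≠ j) (hik : i ≠ k) (hjk : j ≠ k) (hfi : f.1 i = 0) (hfj : f.1 j = 0) (hfk : f.1 k ≠ 0)
    (hgi : g.1 i = 0) (hgj : g.1 j ≠ 0) (hgk : g.1 k = 0)
    (hhi : h.1 i ≠ 0) (hhj : h.1 j = 0) (hhk : h.1 k = 0) {a b c : ℝ} (ha : a ≠ 0) (hb : b ≠ 0)
    (hc : c ≠ 0) (hpa : AllPos m i (a • f)) (hpb : AllPos m k (b • g)) (hpc : AllPos m j (c • h)) :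
    False := by
  -- Again each direction is split between two of the three cells; at most three lines are lost.
  have s1 := H.sum_le hij hik hjk ha (neg_ne_zero.2 hb) hc
  have s2 := H.sum_le hij hik hjk (neg_ne_zero.2 ha) hb hc
  have s3 := H.sum_le hij hik hjk ha hb (neg_ne_zero.2 hc)
  have q1 : posCount m i ((-b) • g) ≤ hitCount m i (a • f) ((-b) • g) (c • h) :=
    posCount_le_two_parallel hfi hgi hhi hc hpa
  have q2 : posCount m j (a • f) ≤ hitCount m j (a • f) ((-b) • g) (c • h) :=
    posCount_le_two_parallel_rotate' hhj hfj hgj (neg_ne_zero.2 hb) hpc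
  have q3 : posCount m k (c • h) ≤ hitCount m k ((-a) • f) (b • g) (c • h) :=
    posCount_le_two_parallel_rotate hgk hhk hfk (neg_ne_zero.2 ha) hpb
  have q4 : posCount m j ((-a) • f) ≤ hitCount m j ((-a) • f) (b • g) (c • h) :=
    posCount_le_two_parallel_rotate' hhj hfj hgj hb hpc
  have q5 : posCount m i (b • g) ≤ hitCount m i (a • f) (b • g) ((-c) • h) :=
    posCount_le_two_parallel hfi hgi hhi (neg_ne_zero.2 hc) hpa
  have q6 : posCount m k ((-c) • h) ≤ hitCount m k (a • f) (b • g) ((-c) • h) :=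
    posCount_le_two_parallel_rotate hgk hhk hfk ha hpb
  have p1 := posCount_add (m := m) g i hb
  have p2 := posCount_add (m := m) f j ha
  have p3 := posCount_add (m := m) h k hc
  have z1 : zeroCount m i g ≤ 1 := zeroCount_orthogonal_le_one hik hij hjk.symm hgk hgj
  have z2 : zeroCount m j f ≤ 1 := zeroCount_orthogonal_le_one hij.symm hjk hik hfi hfk
  have z3 : zeroCount m k h ≤ 1 := zeroCount_orthogonal_le_one hjk.symm hik.symm hij.symm hhj hhi
  omega

/-- Each plane leaves one of two directions uncut. In six of the eight combinations some direction
is uncut by both planes parallel to it; the other two are the two cyclic orientations. -/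
theorem false_of_mutually_orthogonal (H : AllCellsLight m f g h)
    (hij : i ≠ j) (hik : i ≠ k) (hjk : j ≠ k) (hfi : f.1 i = 0) (hfj : f.1 j = 0) (hfk : f.1 k ≠ 0)
    (hgi : g.1 i = 0) (hgj : g.1 j ≠ 0) (hgk : g.1 k = 0)
    (hhi : h.1 i ≠ 0) (hhj : h.1 j = 0) (hhk : h.1 k = 0) : False := by
  rcases exists_allPos (m := m) hij hik hjk hfi hfj hfk with ⟨a, ha, hpa⟩ | ⟨a, ha, hpa⟩ <;>
  rcases exists_allPos (m := m) hik hij hjk.symm hgi hgk hgj with ⟨b, hb, hpb⟩ | ⟨b, hb, hpb⟩ <;>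
  rcases exists_allPos (m := m) hjk hij.symm hik.symm hhj hhk hhi with
    ⟨c, hc, hpc⟩ | ⟨c, hc, hpc⟩
  · exact H.false_of_allPos_two hfi hgi hhi ha hb hpa hpb
  · exact H.false_of_allPos_two hfi hgi hhi ha hb hpa hpb
  · exact H.false_of_cyclic_allPos hij hik hjk hfi hfj hfk hgi hgj hgk hhi hhj hhk ha hb hc
      hpa hpb hpc
  · exact H.swap12.swap23.false_of_allPos_two hgk hhk hfk hb hc hpb hpc
  · exact H.swap23.false_of_allPos_two hfj hhj hgj ha hc hpa hpc
  · exact H.swap23.false_of_cyclic_allPos hij.symm hjk hik hfj hfi hfk hhj hhi hhk hgj hgi hgk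
      ha hc hb hpa hpc hpb
  · exact H.swap23.false_of_allPos_two hfj hhj hgj ha hc hpa hpc
  · exact H.swap12.swap23.false_of_allPos_two hgk hhk hfk hb hc hpb hpc

theorem false_of_orthogonal (H : AllCellsLight m f g h)
    (hij : i ≠ j) (hik : i ≠ k) (hjk : j ≠ k)
    (hfi : f.1 i = 0) (hfj : f.1 j = 0) (hfk : f.1 k ≠ 0)
    (hg : g.1 i ≠ 0 ∨ g.1 j ≠ 0 ∨ g.1 k ≠ 0) (hh : h.1 i ≠ 0 ∨ h.1 j ≠ 0 ∨ h.1 k ≠ 0) :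
    False := by
  wlog hgk : g.1 k = 0 generalizing g h
  · exact this H.swap23 hh hg (((H.exists_parallel k).resolve_left hfk).resolve_left hgk)
  by_cases hhk : h.1 k = 0
  · wlog hpos : ∃ a : ℝ, a ≠ 0 ∧ AllPos m i (a • f) generalizing i j
    · refine this hij.symm hjk hik hfj hfi ?_ ?_
        ((exists_allPos hij hik hjk hfi hfj hfk).resolve_left hpos) <;> tauto
    obtain ⟨a, ha, hpa⟩ := hpos
    wlog hgi : g.1 i = 0 generalizing g h
    · by_cases hhi : h.1 i = 0
      · apply this H.swap23 <;> assumption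
      · exact H.false_of_allPos_one hfi hgi hhi ha hpa
    have hgj : g.1 j ≠ 0 := by tauto
    by_cases hhi : h.1 i = 0
    · exact H.swap12.swap23.false_of_two_orthogonal hik hij hjk.symm hgi hgk hgj hhi hhk
        (by tauto) hfj (Or.inr hfk)
    by_cases hhj : h.1 j = 0
    · exact H.false_of_mutually_orthogonal hij hik hjk hfi hfj hfk hgi hgj hgk hhi hhj hhk
    · exact H.false_of_orthogonal_of_oblique hij hik hjk hfi hfj hfk hgi hgj hgk hhi hhj hhk
  · by_cases ho : h.1 i = 0 ∧ h.1 j = 0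
    · exact H.swap23.false_of_two_orthogonal hij hik hjk hfi hfj hfk ho.1 ho.2 hhk hgk
        (by tauto)
    -- If `f` alone is parallel to axis `i` and `g` alone to axis `k`, four contained lines are
    -- needed, but there are at most `1 + 2`.
    have pair : ∀ {i j : Fin 3}, i ≠ j → i ≠ k → j ≠ k → f.1 i = 0 → f.1 j = 0 →
        g.1 i ≠ 0 → h.1 i ≠ 0 → False := by
      intro i j hij hik hjk hfi hfj hgi hhi
      have h4 := H.four_le_zeroCount hik hij hjk.symm hfi hgi hhi hfk hgk hhk
      have z1 : zeroCount m i f ≤ 1 := zeroCount_orthogonal_le_one hij hik hjk hfj hfk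
      have z2 : zeroCount m k g ≤ 2 := zeroCount_le_two hik.symm hjk.symm hij (Or.inl hgi)
      omega
    wlog hgi : g.1 i ≠ 0 generalizing i j
    · refine this hij.symm hjk hik hfj hfi ?_ ?_ ?_ ?_ <;> tauto
    have hhi : h.1 i = 0 := by
      by_contra hhi
      exact pair hij hik hjk hfi hfj hgi hhi
    have hhj : h.1 j ≠ 0 := by tauto
    have hgj : g.1 j = 0 := by
      by_contra hgj
      exact pair hij.symm hjk hik hfj hfi hgj hhj
    exact H.swap12.false_of_orthogonal_of_oblique hjk hij.symm hik.symm hgj hgk hgi hfj hfk hfi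
      hhj hhk hhi

/-! ### No plane orthogonal to an axis -/

theorem false_of_three_oblique (H : AllCellsLight m f g h) (hm : 3 ≤ m)
    (hij : i ≠ j) (hik : i ≠ k) (hjk : j ≠ k)
    (hfi : f.1 i = 0) (hfj : f.1 j ≠ 0) (hfk : f.1 k ≠ 0)
    (hgi : g.1 i ≠ 0) (hgj : g.1 j = 0) (hgk : g.1 k ≠ 0)
    (hhi : h.1 i ≠ 0) (hhj : h.1 j ≠ 0) (hhk : h.1 k = 0) : False := by
  have h1 := H.four_le_zeroCount hij hik hjk hfi hgi hhi hfj hgj hhj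
  have h2 := H.swap23.four_le_zeroCount hik hij hjk.symm hfi hhi hgi hfk hhk hgk
  have z1 : zeroCount m i f ≤ 2 := zeroCount_le_two hij hik hjk (Or.inl hfj)
  have z2 : zeroCount m j g ≤ 2 := zeroCount_le_two hij.symm hjk hik (Or.inl hgi)
  have z3 : zeroCount m k h ≤ 2 := zeroCount_le_two hik.symm hjk.symm hij (Or.inl hhi)
  -- The bounds force exactly two contained lines in each direction, and a nonpositive product would
  -- allow only one.
  have w1 : 0 < f.1 j * f.1 k := by
    by_contra hcon
    have := zeroCount_le_one (m := m) hij hik hjk (Or.inl hfj) hcon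
    omega
  have w2 : 0 < g.1 i * g.1 k := by
    by_contra hcon
    have := zeroCount_le_one (m := m) hij.symm hjk hik (Or.inl hgi) hcon
    omega
  have w3 : 0 < h.1 i * h.1 j := by
    by_contra hcon
    have := zeroCount_le_one (m := m) hik.symm hjk.symm hij (Or.inl hhi) hcon
    omega
  have ha : f.1 j * h.1 j ≠ 0 := mul_ne_zero hfj hhj
  have hb : g.1 i * h.1 i ≠ 0 := mul_ne_zero hgi hhi
  have key : ∀ e : ℝ, e ≠ 0 → posCount m i ((e * (f.1 j * h.1 j)) • f)
      + posCount m j ((e * (g.1 i * h.1 i)) • g) + posCount m k (e • h) + 2 ≤ m := by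
    intro e he
    have s := H.sum_le hij hik hjk (mul_ne_zero he ha) (mul_ne_zero he hb) he
    have q1 : posCount m i ((e * (f.1 j * h.1 j)) • f)
        ≤ hitCount m i ((e * (f.1 j * h.1 j)) • f) ((e * (g.1 i * h.1 i)) • g) (e • h) := by
      refine posCount_le_one_parallel hfi (mul_ne_zero he hb) ?_
      have := mul_self_pos.2 (mul_ne_zero he hb)
      linarith
    have q2 : posCount m j ((e * (g.1 i * h.1 i)) • g)
        ≤ hitCount m j ((e * (f.1 j * h.1 j)) • f) ((e * (g.1 i * h.1 i)) • g) (e • h) := by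
      rw [hitCount_swap12]
      refine posCount_le_one_parallel hgj (mul_ne_zero he ha) ?_
      have := mul_self_pos.2 (mul_ne_zero he ha)
      linarith
    have q3 : posCount m k (e • h)
        ≤ hitCount m k ((e * (f.1 j * h.1 j)) • f) ((e * (g.1 i * h.1 i)) • g) (e • h) := by
      rw [← hitCount_rotate]
      refine posCount_le_one_parallel hhk (mul_ne_zero he ha) ?_
      -- The weights were fitted to directions `i` and `j`. For `k` the required product regroups as
      -- `e²` times the three positive products `w1`, `w2`, `w3`.
      have := mul_pos (mul_pos (mul_self_pos.2 he) w3) (mul_pos w1 w2)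
      linarith
    omega
  have k1 := key 1 one_ne_zero
  have k2 := key (-1) (neg_ne_zero.2 one_ne_zero)
  simp only [one_mul, neg_one_mul] at k1 k2
  have p1 := posCount_add (m := m) f i ha
  have p2 := posCount_add (m := m) g j hb
  have p3 := posCount_add (m := m) h k (one_ne_zero (α := ℝ))
  -- Opposite cells give `3m - 6 ≤ 2(m - 2)`; this is where `3 ≤ m` enters.
  omega

end AllCellsLight

/-- A nonzero vector that is not a multiple of a basis vector has at most one zero coordinate. -/
theorem ne_zero_of_not_orthogonal {v : Fin 3 → ℝ} (hv : v ≠ 0)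
    (ho : ∀ i j k : Fin 3, i ≠ j → i ≠ k → j ≠ k → v i = 0 → v j = 0 → v k = 0) {i j : Fin 3}
    (hi : v i = 0) (hij : i ≠ j) : v j ≠ 0 := by
  intro hj
  obtain ⟨k, hik, hjk⟩ : ∃ k, i ≠ k ∧ j ≠ k := by clear * -; revert i j; decide
  refine hv (funext fun l => ?_)
  have : l = i ∨ l = j ∨ l = k := by clear hi hj ho hv; revert i j k l; decide
  rcases this with rfl | rfl | rfl
  exacts [hi, hj, ho _ _ _ hij hik hjk hi hj]

theorem not_allCellsLight (hm : 3 ≤ m) (hf : f.1 ≠ 0) (hg : g.1 ≠ 0) (hh : h.1 ≠ 0) :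
    ¬ AllCellsLight m f g h := by
  intro H
  have some_ne : ∀ {v : Fin 3 → ℝ}, v ≠ 0 → ∀ {i j k : Fin 3}, i ≠ j → i ≠ k → j ≠ k →
      v i ≠ 0 ∨ v j ≠ 0 ∨ v k ≠ 0 := by
    intro v hv i j k hij hik hjk
    by_contra! hcon
    exact ne_zero_of_not_orthogonal hv (fun i' j' k' _ _ _ _ _ => by
      have : k' = i ∨ k' = j ∨ k' = k := by clear * - hij hik hjk; revert i j k k'; decide
      rcases this with rfl | rfl | rfl
      exacts [hcon.1, hcon.2.1, hcon.2.2]) hcon.1 hij hcon.2.1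
  have of : ∀ i j k : Fin 3, i ≠ j → i ≠ k → j ≠ k → f.1 i = 0 → f.1 j = 0 → f.1 k = 0 := by
    intro i j k hij hik hjk hi hj
    by_contra hk
    exact H.false_of_orthogonal hij hik hjk hi hj hk (some_ne hg hij hik hjk)
      (some_ne hh hij hik hjk)
  have og : ∀ i j k : Fin 3, i ≠ j → i ≠ k → j ≠ k → g.1 i = 0 → g.1 j = 0 → g.1 k = 0 := by
    intro i j k hij hik hjk hi hj
    by_contra hk
    exact H.swap12.false_of_orthogonal hij hik hjk hi hj hk (some_ne hf hij hik hjk)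
      (some_ne hh hij hik hjk)
  have oh : ∀ i j k : Fin 3, i ≠ j → i ≠ k → j ≠ k → h.1 i = 0 → h.1 j = 0 → h.1 k = 0 := by
    intro i j k hij hik hjk hi hj
    by_contra hk
    exact H.swap23.swap12.false_of_orthogonal hij hik hjk hi hj hk (some_ne hf hij hik hjk)
      (some_ne hg hij hik hjk)
  have nf := fun {i j : Fin 3} => ne_zero_of_not_orthogonal (i := i) (j := j) hf of
  have ng := fun {i j : Fin 3} => ne_zero_of_not_orthogonal (i := i) (j := j) hg og
  have nh := fun {i j : Fin 3} => ne_zero_of_not_orthogonal (i := i) (j := j) hh oh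
  have d01 : (0 : Fin 3) ≠ 1 := by decide
  have d02 : (0 : Fin 3) ≠ 2 := by decide
  have d12 : (1 : Fin 3) ≠ 2 := by decide
  have main : ∀ {i j k : Fin 3}, i ≠ j → i ≠ k → j ≠ k → f.1 i = 0 → g.1 j = 0 → h.1 k = 0 →
      False := fun hij hik hjk h1 h2 h3 =>
    H.false_of_three_oblique hm hij hik hjk h1 (nf h1 hij) (nf h1 hik) (ng h2 hij.symm) h2
      (ng h2 hjk) (nh h3 hik.symm) (nh h3 hjk.symm) h3
  -- Of the 27 assignments of planes to axes, those using a plane twice are excluded; the six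
  -- bijections remain.
  rcases H.exists_parallel 0 with h0 | h0 | h0 <;>
  rcases H.exists_parallel 1 with h1 | h1 | h1 <;>
  rcases H.exists_parallel 2 with h2 | h2 | h2 <;>
  first
  | exact nf h0 d01 h1
  | exact nf h0 d02 h2
  | exact nf h1 d12 h2
  | exact ng h0 d01 h1
  | exact ng h0 d02 h2
  | exact ng h1 d12 h2
  | exact nh h0 d01 h1
  | exact nh h0 d02 h2
  | exact nh h1 d12 h2
  | exact main d01 d02 d12 h0 h1 h2
  | exact main d02 d01 d12.symm h0 h2 h1
  | exact main d01.symm d12 d02 h1 h0 h2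
  | exact main d12 d01.symm d02.symm h1 h2 h0
  | exact main d02.symm d12.symm d01 h2 h0 h1
  | exact main d12.symm d02.symm d01.symm h2 h1 h0

end

/-! ### From sign cells to open cells in `Space3` -/

/-- The line number `t` among the lines parallel to axis `i`. -/
noncomputable def axisLine (p : Fin 3 × ℕ) : AffineSubspace ℝ Space3 :=
  AffineSubspace.mk' (WithLp.toLp 2 (linePoint p.1 p.2 0))
    (Submodule.span ℝ {EuclideanSpace.single p.1 (1 : ℝ)})

theorem isAxisParallelLine_axisLine (p : Fin 3 × ℕ) : IsAxisParallelLine (axisLine p) :=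
  ⟨⟨_, AffineSubspace.self_mem_mk' _ _⟩, p.1, AffineSubspace.direction_mk' _ _⟩

theorem mem_axisLine_iff (p : Fin 3 × ℕ) (x : Space3) :
    x ∈ axisLine p ↔ ∃ s, x = WithLp.toLp 2 (linePoint p.1 p.2 s) := by
  rw [axisLine, AffineSubspace.mem_mk', Submodule.mem_span_singleton]
  refine exists_congr fun s => ?_
  have key : WithLp.toLp 2 (linePoint p.1 p.2 s)
      = s • EuclideanSpace.single p.1 (1 : ℝ) + WithLp.toLp 2 (linePoint p.1 p.2 0) := by
    ext l
    by_cases hl : l = p.1 <;> simp [linePoint, hl]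
  rw [key, vsub_eq_sub, eq_sub_iff_add_eq, eq_comm]

theorem axisLine_injective : Function.Injective axisLine := by
  rintro ⟨i, t⟩ ⟨j, u⟩ h
  have hd := congrArg AffineSubspace.direction h
  simp only [axisLine, AffineSubspace.direction_mk'] at hd
  have hij : i = j := by
    have h1 : EuclideanSpace.single i (1 : ℝ) ∈
        Submodule.span ℝ {EuclideanSpace.single j (1 : ℝ)} := by
      rw [← hd]
      exact Submodule.mem_span_singleton_self _
    obtain ⟨a, ha⟩ := Submodule.mem_span_singleton.1 h1
    by_contra hij
    have h2 := congrArg (fun v : Space3 => v i) ha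
    simp [hij] at h2
  subst hij
  have h1 : WithLp.toLp 2 (linePoint i t 0) ∈ axisLine (i, u) :=
    h ▸ AffineSubspace.self_mem_mk' _ _
  obtain ⟨s, hs⟩ := (mem_axisLine_iff _ _).1 h1
  have h2 := congrArg (fun v : Space3 => v (i + 1)) hs
  have h3 : (t : ℝ) = u := by simpa [linePoint] using h2
  rw [Nat.cast_injective h3]

theorem IsPlane.exists_affineForm {h : AffineSubspace ℝ Space3} (hh : IsPlane h) :
    ∃ f : AffineForm, f.1 ≠ 0 ∧ ∀ x : Space3, x ∈ h ↔ f.eval x.ofLp = 0 := by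
  obtain ⟨⟨x₀, hx₀⟩, hrank⟩ := hh
  have h1 : Module.finrank ℝ h.directionᗮ = 1 := by
    have := h.direction.finrank_add_finrank_orthogonal
    rw [hrank, finrank_euclideanSpace_fin] at this
    omega
  obtain ⟨⟨v, hv⟩, hv0, hspan⟩ := finrank_eq_one_iff'.1 h1
  have hv0 : v ≠ 0 := fun h => hv0 (Subtype.ext h)
  refine ⟨(v.ofLp, inner ℝ v x₀), fun h => hv0 (by ext l; exact congrFun h l), fun x => ?_⟩
  have e1 : AffineForm.eval (v.ofLp, inner ℝ v x₀) x.ofLp = inner ℝ v (x - x₀) := by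
    rw [inner_sub_right]
    simp [AffineForm.eval, PiLp.inner_apply, Fin.sum_univ_three, mul_comm]
  rw [e1, ← AffineSubspace.vsub_right_mem_direction_iff_mem hx₀, vsub_eq_sub]
  constructor
  · intro hx
    rw [real_inner_comm]
    exact hv _ hx
  · intro hx
    rw [← Submodule.orthogonal_orthogonal h.direction]
    intro w hw
    obtain ⟨c, hc⟩ := hspan ⟨w, hw⟩
    have hc : c • v = w := congrArg Subtype.val hc
    rw [← hc, inner_smul_left, hx, mul_zero]

/-- An intersection of convex sets is convex. -/
theorem isPreconnected_pos (f g h : AffineForm) :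
    IsPreconnected {x : Space3 | 0 < f.eval x.ofLp ∧ 0 < g.eval x.ofLp ∧ 0 < h.eval x.ofLp} := by
  have hc : ∀ f : AffineForm, Convex ℝ {x : Space3 | 0 < f.eval x.ofLp} := by
    intro f x hx y hy a b ha hb hab
    have e : f.eval (a • x + b • y).ofLp = a * f.eval x.ofLp + b * f.eval y.ofLp := by
      simp only [AffineForm.eval, Fin.sum_univ_three, PiLp.add_apply, PiLp.smul_apply, smul_eq_mul]
      linear_combination f.2 * hab
    simp only [Set.mem_ofPred_eq] at hx hy ⊢
    rw [e]
    rcases ha.eq_or_lt with rfl | ha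
    · rw [zero_add] at hab
      subst hab
      simpa using hy
    · have := mul_pos ha hx
      have := mul_nonneg hb hy.le
      linarith
  exact ((hc f).inter ((hc g).inter (hc h))).isPreconnected

/-- A sign cell that meets some line is contained in an open cell of the arrangement. -/
theorem exists_openCell_sum_hitCount_le {L H : Finset (AffineSubspace ℝ Space3)} {m : ℕ}
    {f g h : AffineForm}
    (hL : ∀ i : Fin 3, ∀ t ∈ Finset.Icc 1 m, axisLine (i, t) ∈ L)
    (hH : ∀ x : Space3, 0 < f.eval x.ofLp → 0 < g.eval x.ofLp → 0 < h.eval x.ofLp →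
      x ∈ planesCompl H)
    (hpos : 0 < ∑ i, hitCount m i f g h) :
    ∃ C ∈ openCells H, ∑ i, hitCount m i f g h ≤ meetCount L C := by
  classical
  let hits : Fin 3 → Finset ℕ := fun i => (Finset.Icc 1 m).filter fun t =>
    ∃ s, 0 < f.eval (linePoint i t s) ∧ 0 < g.eval (linePoint i t s) ∧
      0 < h.eval (linePoint i t s)
  have hcard : ∑ i, hitCount m i f g h = ∑ i, (hits i).card := rfl
  obtain ⟨i₀, -, hi₀⟩ := Finset.exists_ne_zero_of_sum_ne_zero hpos.ne'
  obtain ⟨t₀, ht₀⟩ := Finset.card_pos.1 (Nat.pos_of_ne_zero (show (hits i₀).card ≠ 0 from hi₀))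
  obtain ⟨s₀, hs₀⟩ := (Finset.mem_filter.1 ht₀).2
  let x₀ : Space3 := WithLp.toLp 2 (linePoint i₀ t₀ s₀)
  have hsub : {x : Space3 | 0 < f.eval x.ofLp ∧ 0 < g.eval x.ofLp ∧ 0 < h.eval x.ofLp} ⊆
      connectedComponentIn (planesCompl H) x₀ :=
    (isPreconnected_pos f g h).subset_connectedComponentIn hs₀
      fun x hx => hH x hx.1 hx.2.1 hx.2.2
  refine ⟨_, ⟨x₀, hH x₀ hs₀.1 hs₀.2.1 hs₀.2.2, rfl⟩, ?_⟩
  let S : Finset (AffineSubspace ℝ Space3) :=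
    ((Finset.univ : Finset (Fin 3)).sigma hits).image fun p => axisLine (p.1, p.2)
  have hS : S.card = ∑ i, (hits i).card := by
    rw [Finset.card_image_of_injective, Finset.card_sigma]
    rintro ⟨i, t⟩ ⟨j, u⟩ hp
    obtain ⟨rfl, rfl⟩ := Prod.mk.inj (axisLine_injective hp)
    rfl
  rw [hcard, ← hS, ← Set.ncard_coe_finset, meetCount]
  refine Set.ncard_le_ncard ?_ (L.finite_toSet.subset fun l hl => hl.1)
  intro l hl
  obtain ⟨⟨i, t⟩, hp, rfl⟩ := Finset.mem_image.1 (Finset.mem_coe.1 hl)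
  obtain ⟨ht, s, hs⟩ := Finset.mem_filter.1 (Finset.mem_sigma.1 hp).2
  exact ⟨hL i t ht, WithLp.toLp 2 (linePoint i t s),
    (mem_axisLine_iff _ _).2 ⟨s, rfl⟩, hsub hs⟩

theorem exists_openCell_le_meetCount {L H : Finset (AffineSubspace ℝ Space3)} {m : ℕ} (hm : 3 ≤ m)
    (hL : ∀ i : Fin 3, ∀ t ∈ Finset.Icc 1 m, axisLine (i, t) ∈ L)
    (hcard : H.card = 3) (hH : ∀ h ∈ H, IsPlane h) :
    ∃ C ∈ openCells H, m - 1 ≤ meetCount L C := by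
  classical
  obtain ⟨h₁, h₂, h₃, -, -, -, rfl⟩ := Finset.card_eq_three.1 hcard
  obtain ⟨f, hf, hf'⟩ := (hH h₁ (by simp)).exists_affineForm
  obtain ⟨g, hg, hg'⟩ := (hH h₂ (by simp)).exists_affineForm
  obtain ⟨h, hh, hh'⟩ := (hH h₃ (by simp)).exists_affineForm
  have hlight := not_allCellsLight hm hf hg hh
  rw [AllCellsLight] at hlight
  push Not at hlight
  obtain ⟨a, b, c, -, -, -, hlt⟩ := hlight
  have compl : ∀ x : Space3, 0 < AffineForm.eval (a • f) x.ofLp →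
      0 < AffineForm.eval (b • g) x.ofLp → 0 < AffineForm.eval (c • h) x.ofLp →
      x ∈ planesCompl {h₁, h₂, h₃} := by
    intro x hx hy hz l hl hxl
    rw [AffineForm.eval_smul] at hx hy hz
    simp only [Finset.mem_insert, Finset.mem_singleton] at hl
    rcases hl with rfl | rfl | rfl
    · simp [(hf' x).1 hxl] at hx
    · simp [(hg' x).1 hxl] at hy
    · simp [(hh' x).1 hxl] at hz
  -- The sign cell meets at least `m - 1 ≥ 2` lines, so it is nonempty and determines an open cell.
  obtain ⟨C, hC, hle⟩ := exists_openCell_sum_hitCount_le hL compl (by omega)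
  exact ⟨C, hC, by omega⟩

theorem corollary2 (n : ℕ) (hn : 9 ≤ n) :
    n / 3 - 1 ≤ gMax n ∧
    ∃ L : Finset (AffineSubspace ℝ Space3),
      L.card = n ∧ (∀ l ∈ L, IsAxisParallelLine l) ∧
      ∀ H : Finset (AffineSubspace ℝ Space3), H.card = 3 → (∀ h ∈ H, IsPlane h) →
        ∃ C ∈ openCells H, n / 3 - 1 ≤ meetCount L C := by
  classical
  -- The bound on `gMax n` follows from the explicit set of lines.
  rw [and_iff_right_of_imp]
  · let lines : ℕ → Finset (AffineSubspace ℝ Space3) := fun m =>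
      ((Finset.univ : Finset (Fin 3)) ×ˢ Finset.Icc 1 m).image axisLine
    have hcard : ∀ m, (lines m).card = 3 * m := fun m => by
      simp [lines, Finset.card_image_of_injective _ axisLine_injective]
    -- When `3` does not divide `n`, further lines of the same family fill up the set; they can only
    -- increase the counts.
    obtain ⟨L, hL1, hL2, hL⟩ := Finset.exists_subsuperset_card_eq (s := lines (n / 3))
      (t := lines n) (n := n)
      (Finset.image_subset_image (Finset.product_subset_product_right
        (Finset.Icc_subset_Icc_right (Nat.div_le_self n 3))))
      (by rw [hcard]; omega) (by rw [hcard]; omega)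
    refine ⟨L, hL, fun l hl => ?_, fun H h3 hH => ?_⟩
    · obtain ⟨p, -, rfl⟩ := Finset.mem_image.1 (hL2 hl)
      exact isAxisParallelLine_axisLine p
    · refine exists_openCell_le_meetCount (by omega) (fun i t ht => hL1 ?_) h3 hH
      exact Finset.mem_image_of_mem _ (Finset.mk_mem_product (Finset.mem_univ i) ht)
  · rintro ⟨L, hL, hpar, hcell⟩
    obtain ⟨H, hH, hle⟩ := (isLeast_gLines L).1
    obtain ⟨C, hC, hlow⟩ := hcell H hH.1 hH.2
    exact (hlow.trans (hle C hC)).trans ((isGreatest_gMax n).2 ⟨L, hL, hpar, rfl⟩)
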